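/- Let $t_0<T$, let $\kappa_i>0$, $\xi_i>0$, and let $W_i$ be a standard Brownian motion on $[t_0,T]$ under a probability measure (with expectation $\mathbb E$). Let $q_i$ be a Hull–White collateral spread, i.e. a process with continuous paths satisfying $$\mathrm d q_i(t)=\kappa_i\bigl(\theta_i(t)-q_i(t)\bigr)\,\mathrm dt+\xi_i\,\mathrm dW_i(t),\qquad t\in(t_0,T],$$ where the long-term mean $\theta_i$ is a deterministic real function, and with deterministic initial value $q_i(t_0)=\hat q_i(t_0)$ almost surely. 1. Let $\hat q_i$ be continuously differentiable on $[t_0,T]$ (with one-sided derivatives at the endpoints). If $$\theta_i(t)=\hat q_i(t)+\frac{\partial}{\partial t}\,\frac1{\kappa_i}\hat q_i(t),\qquad t\in(t_0,T],$$ then, for every $t\in[t_0,T]$, $q_i(t)$ is integrable and $\mathbb E[q_i(t)]=\hat q_i(t)$. 2. Let $t_0<t_1<\dots<t_R=T$ be a discretization of $[t_0,T]$ and let real values $\hat q_i(t_k)$, $k=0,\dots,R$, be given. If, for every $k=1,\dots,R$, $$\theta_i(t)=\frac{\hat q_i(t_k)\,e^{\kappa_i t_k}-\hat q_i(t_{k-1})\,e^{\kappa_i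 t_{k-1}}}{e^{\kappa_i t_k}-e^{\kappa_i t_{k-1}}},\qquad t\in(t_{k-1},t_k],$$ then, for every $k=0,\dots,R$, $q_i(t_k)$ is integrable and $\mathbb E[q_i(t_k)]=\hat q_i(t_k)$. -/

import Mathlib

open MeasureTheory ProbabilityTheory Set

/-- `W` is a standard real Brownian motion on the time interval `[a, b]` under `P`: the increments
over `[a, b]` are independent, `W t - W s` has law `N(0, t - s)`, and the paths are almost surely
continuous. Only increments matter, so the starting value `W a` is left free; the restriction to
`[a, b]` of a Brownian motion started at an earlier time is thus included. -/
structure IsBrownianMotionOn {Ω : Type*} [MeasurableSpace Ω] (W : ℝ → Ω → ℝ) (a b : ℝ)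
    (P : Measure Ω) : Prop where
  aemeasurable : ∀ t ∈ Icc a b, AEMeasurable (W t) P
  hasLaw_increment : ∀ s ∈ Icc a b, ∀ t ∈ Icc a b, s ≤ t →
    HasLaw (fun ω ↦ W t ω - W s ω) (gaussianReal 0 (t - s).toNNReal) P
  indep_increments : HasIndepIncrements (fun t : Icc a b ↦ W t) P
  continuous_paths : ∀ᵐ ω ∂P, ContinuousOn (fun t ↦ W t ω) (Icc a b)

/-- `q` solves on `[t₀, T]`, under `P`, the one-factor Hull-White equation
`dq(t) = κ (θ(t) - q(t)) dt + ξ dW(t)`, `t ∈ (t₀, T]`, in its usual integrated form: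
`q` is a process with almost surely continuous paths, its drift is almost surely integrable over
`[t₀, T]`, and almost surely, for all `t ∈ [t₀, T]`,
`q(t) = q(t₀) + ∫_{t₀}^t κ (θ(s) - q(s)) ds + ∫_{t₀}^t ξ dW(s)`.
The volatility `ξ` is constant, so the last (Ito) integral is `ξ (W(t) - W(t₀))`. -/
structure IsHullWhiteProcess {Ω : Type*} [MeasurableSpace Ω] (q : ℝ → Ω → ℝ) (t₀ T κ ξ : ℝ)
    (θ : ℝ → ℝ) (W : ℝ → Ω → ℝ) (P : Measure Ω) : Prop where
  aemeasurable : ∀ t ∈ Icc t₀ T, AEMeasurable (q t) P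
  continuous_paths : ∀ᵐ ω ∂P, ContinuousOn (fun t ↦ q t ω) (Icc t₀ T)
  integrable_drift : ∀ᵐ ω ∂P, IntervalIntegrable (fun s ↦ κ * (θ s - q s ω)) volume t₀ T
  equation : ∀ᵐ ω ∂P, ∀ t ∈ Icc t₀ T,
    q t ω = q t₀ ω + (∫ s in t₀..t, κ * (θ s - q s ω)) + ξ * (W t ω - W t₀ ω)

/-! Let `m` solve `m' = κ (θ - m)` with `m a` the initial mean. Subtracting `m` and the noise from a
path of `q` leaves a linear integral equation with continuous data, free of `θ`. Solving it path by
path writes `q t` as `m t` plus multiples of `q a - m a`, of `W t - W a`, and of a weighted time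
integral of `W s - W a`. These are centred, the last by Fubini, so no prior integrability of `q t`
and no stochastic integral is needed. A smooth curve is itself such an `m`; on a grid, `θ` is
constant on each cell and the cells are chained by induction. -/

/-- Variation of constants for the scalar linear integral equation
`y t = y a - κ ∫_a^t (y + g)`. -/
lemma eq_exp_mul_sub_integral_of_integral_equation {a b κ : ℝ} {y g : ℝ → ℝ}
    (hyc : ContinuousOn y (Icc a b)) (hg : ContinuousOn g (Icc a b))
    (hy : ∀ t ∈ Icc a b, y t = y a + ∫ s in a..t, -κ * (y s + g s))
    {t : ℝ} (ht : t ∈ Icc a b) :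
    y t = Real.exp (-κ * (t - a)) * y a - κ * ∫ s in a..t, Real.exp (-κ * (t - s)) * g s := by
  have key : ∀ f : ℝ → ℝ, ContinuousOn f (Icc a b) → ∀ x ∈ Ioo a t,
      HasDerivAt (fun u ↦ ∫ s in a..u, f s) (f x) x := by
    intro f hf x hx
    have hxb : x ∈ Ioo a b := ⟨hx.1, hx.2.trans_le ht.2⟩
    refine intervalIntegral.integral_hasDerivAt_right ?_ ?_ ?_
    · refine (hf.mono ?_).intervalIntegrable
      rw [uIcc_of_le hx.1.le]
      exact Icc_subset_Icc_right hxb.2.le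
    · exact (hf.mono Ioo_subset_Icc_self).stronglyMeasurableAtFilter isOpen_Ioo x hxb
    · exact hf.continuousAt (Icc_mem_nhds hxb.1 hxb.2)
  have hsub : Icc a t ⊆ Icc a b := Icc_subset_Icc_right ht.2
  have hG : ContinuousOn (fun s ↦ κ * (Real.exp (κ * (s - a)) * g s)) (Icc a b) := by fun_prop
  have hF := intervalIntegral.integral_eq_sub_of_hasDerivAt_of_le (a := a) (b := t)
    (f := fun u ↦ Real.exp (κ * (u - a)) * y u + ∫ s in a..u, κ * (Real.exp (κ * (s - a)) * g s))
    (f' := fun _ ↦ 0) ht.1 ?_ ?_ ?_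
  · simp only [intervalIntegral.integral_zero, sub_self, mul_zero, Real.exp_zero, one_mul,
      intervalIntegral.integral_same, add_zero, intervalIntegral.integral_const_mul] at hF
    have hI : ∫ s in a..t, Real.exp (-κ * (t - s)) * g s
        = Real.exp (-κ * (t - a)) * ∫ s in a..t, Real.exp (κ * (s - a)) * g s := by
      rw [← intervalIntegral.integral_const_mul]
      congr 1 with s
      rw [← mul_assoc, ← Real.exp_add]
      ring_nf
    have hE : Real.exp (-κ * (t - a)) * Real.exp (κ * (t - a)) = 1 := by
      rw [← Real.exp_add]; simp
    rw [hI]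
    linear_combination (-Real.exp (-κ * (t - a))) * hF - y t * hE
  · refine (ContinuousOn.mul (by fun_prop) (hyc.mono hsub)).add ?_
    have := intervalIntegral.continuousOn_primitive_interval (μ := volume) (a := a) (b := t)
      (f := fun s ↦ κ * (Real.exp (κ * (s - a)) * g s)) ?_
    · rwa [uIcc_of_le ht.1] at this
    · rw [uIcc_of_le ht.1]
      exact (hG.mono hsub).integrableOn_Icc
  · intro x hx
    have hyd : HasDerivAt y (-κ * (y x + g x)) x := by
      have h := (key (fun s ↦ -κ * (y s + g s)) (by fun_prop) x hx).const_add (y a)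
      refine h.congr_of_eventuallyEq ?_
      filter_upwards [Icc_mem_nhds hx.1 hx.2] with u hu using hy u (hsub hu)
    have he : HasDerivAt (fun u ↦ Real.exp (κ * (u - a))) (Real.exp (κ * (x - a)) * κ) x := by
      have := (((hasDerivAt_id x).sub_const a).const_mul κ).exp
      simpa using this
    refine ((he.mul hyd).add (key _ hG x hx)).congr_deriv ?_
    ring
  · exact intervalIntegrable_const

/-! ### Fubini for processes with continuous paths -/

/-- A process with a.e. measurable marginals and almost surely continuous paths over a compact
interval is indistinguishable from a jointly measurable process. -/
lemma exists_measurable_uncurry_version {Ω : Type*} [MeasurableSpace Ω] {P : Measure Ω}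
    {X : ℝ → Ω → ℝ} {a b : ℝ} (hab : a ≤ b) (hX : ∀ t ∈ Icc a b, AEMeasurable (X t) P)
    (hc : ∀ᵐ ω ∂P, ContinuousOn (fun t ↦ X t ω) (Icc a b)) :
    ∃ Y : ℝ → Ω → ℝ, Measurable (Function.uncurry Y) ∧
      ∀ᵐ ω ∂P, ∀ t ∈ Icc a b, Y t ω = X t ω := by
  classical
  -- Countability of `D` gives one null set off which `X` agrees with measurable versions on all of
  -- `D`; path continuity then makes every marginal a pointwise limit of measurable functions on
  -- `G`.
  obtain ⟨D, hDc, hDd⟩ := TopologicalSpace.exists_countable_dense (Icc a b)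
  have hgood : ∀ᵐ ω ∂P, ContinuousOn (fun t ↦ X t ω) (Icc a b) ∧
      ∀ d : Icc a b, (hd : d ∈ D) → X d ω = (hX d d.2).mk _ ω := by
    filter_upwards [hc, (ae_ball_iff hDc).2 fun d _ ↦ (hX d d.2).ae_eq_mk] with ω h1 h2
    exact ⟨h1, h2⟩
  obtain ⟨G, hGae, hGm, hG⟩ := hgood.exists_measurable_mem
  refine ⟨fun t ↦ G.indicator (X (projIcc a b hab t)), ?_, ?_⟩
  · have hcont : ∀ ω, Continuous fun t ↦ G.indicator (X (projIcc a b hab t)) ω := by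
      intro ω
      by_cases hω : ω ∈ G
      · simp only [indicator_of_mem hω]
        exact (hG ω hω).1.domRestrict.comp continuous_projIcc
      · simp only [indicator_of_notMem hω]
        exact continuous_const
    have hmeas : ∀ x : Icc a b, Measurable (G.indicator (X x)) := by
      intro x
      obtain ⟨u, huD, hu⟩ := mem_closure_iff_seq_limit.1 (hDd x)
      refine measurable_of_tendsto_metrizable
        (f := fun n ↦ G.indicator ((hX (u n) (u n).2).mk _))
        (fun n ↦ (hX (u n) (u n).2).measurable_mk.indicator hGm) ?_
      rw [tendsto_pi_nhds]
      intro ω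
      by_cases hω : ω ∈ G
      · simp only [indicator_of_mem hω]
        refine ((((hG ω hω).1.domRestrict).tendsto x).comp hu).congr fun n ↦ ?_
        exact (hG ω hω).2 (u n) (huD n)
      · simp only [indicator_of_notMem hω]
        exact tendsto_const_nhds
    exact measurable_uncurry_of_continuous_of_measurable hcont fun t ↦ hmeas _
  · filter_upwards [hGae] with ω hω t ht
    rw [indicator_of_mem hω, projIcc_of_mem hab ht]

/-- A weighted time integral of a centred process with bounded first moments is centred. -/
lemma integrable_and_integral_intervalIntegral_eq_zero {Ω : Type*} [MeasurableSpace Ω]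
    {P : Measure Ω} [IsProbabilityMeasure P] {X : ℝ → Ω → ℝ} {a b C : ℝ} (hab : a ≤ b)
    (hX : ∀ t ∈ Icc a b, Integrable (X t) P) (hX0 : ∀ t ∈ Icc a b, ∫ ω, X t ω ∂P = 0)
    (hXC : ∀ t ∈ Icc a b, ∫ ω, |X t ω| ∂P ≤ C)
    (hc : ∀ᵐ ω ∂P, ContinuousOn (fun t ↦ X t ω) (Icc a b))
    {w : ℝ → ℝ} (hw : Continuous w) :
    Integrable (fun ω ↦ ∫ s in a..b, w s * X s ω) P ∧
      ∫ ω, (∫ s in a..b, w s * X s ω) ∂P = 0 := by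
  obtain ⟨Y, hYm, hYX⟩ := exists_measurable_uncurry_version hab
    (fun t ht ↦ (hX t ht).aestronglyMeasurable.aemeasurable) hc
  have hYt : ∀ t ∈ Icc a b, Y t =ᵐ[P] X t := fun t ht ↦ by
    filter_upwards [hYX] with ω h using h t ht
  obtain ⟨M, hM⟩ := isCompact_Icc.exists_bound_of_continuousOn (hw.continuousOn (s := Icc a b))
  let μ : Measure ℝ := volume.restrict (Ioc a b)
  have hmem : ∀ᵐ s ∂μ, s ∈ Icc a b := by
    filter_upwards [ae_restrict_mem measurableSet_Ioc] with s hs using Ioc_subset_Icc_self hs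
  let f : ℝ × Ω → ℝ := fun p ↦ w p.1 * Y p.1 p.2
  have hfm : Measurable f := (hw.measurable.comp measurable_fst).mul hYm
  have hf : Integrable f (μ.prod P) := by
    rw [integrable_prod_iff hfm.aestronglyMeasurable]
    constructor
    · filter_upwards [hmem] with s hs
      exact ((hX s hs).congr (hYt s hs).symm).const_mul (w s)
    · refine Integrable.of_bound
        (hfm.norm.stronglyMeasurable.integral_prod_right).aestronglyMeasurable (M * C) ?_
      filter_upwards [hmem] with s hs
      have h1 : ∫ ω, ‖f (s, ω)‖ ∂P = |w s| * ∫ ω, |X s ω| ∂P := by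
        rw [← integral_const_mul]
        refine integral_congr_ae ?_
        filter_upwards [hYt s hs] with ω h
        simp [f, h]
      rw [h1, Real.norm_of_nonneg (by positivity)]
      have h0 : 0 ≤ ∫ ω, |X s ω| ∂P := by positivity
      exact mul_le_mul (hM s hs) (hXC s hs) h0 ((abs_nonneg _).trans (hM s hs))
  have hae : (fun ω ↦ ∫ s, f (s, ω) ∂μ) =ᵐ[P] fun ω ↦ ∫ s in a..b, w s * X s ω := by
    filter_upwards [hYX] with ω h
    rw [intervalIntegral.integral_of_le hab]
    refine integral_congr_ae ?_
    filter_upwards [hmem] with s hs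
    simp [f, h s hs]
  refine ⟨hf.integral_prod_right.congr hae, ?_⟩
  rw [← integral_congr_ae hae, ← integral_integral_swap (f := fun s ω ↦ f (s, ω)) hf]
  refine integral_eq_zero_of_ae ?_
  filter_upwards [hmem] with s hs
  have h1 : ∫ ω, f (s, ω) ∂P = w s * ∫ ω, Y s ω ∂P := integral_const_mul (w s) (Y s)
  simp [h1, integral_congr_ae (hYt s hs), hX0 s hs]

/-! ### Restriction to subintervals -/

lemma IsBrownianMotionOn.mono {Ω : Type*} [MeasurableSpace Ω] {P : Measure Ω}
    {W : ℝ → Ω → ℝ} {a b a' b' : ℝ} (hW : IsBrownianMotionOn W a b P) (ha : a ≤ a')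
    (hb : b' ≤ b) : IsBrownianMotionOn W a' b' P where
  aemeasurable t ht := hW.aemeasurable t (Icc_subset_Icc ha hb ht)
  hasLaw_increment s hs t ht hst :=
    hW.hasLaw_increment s (Icc_subset_Icc ha hb hs) t (Icc_subset_Icc ha hb ht) hst
  indep_increments := fun n u hu ↦
    hW.indep_increments n (fun i ↦ inclusion (Icc_subset_Icc ha hb) (u i)) fun _ _ h ↦ hu h
  continuous_paths := hW.continuous_paths.mono fun _ h ↦ h.mono (Icc_subset_Icc ha hb)

lemma IsHullWhiteProcess.mono {Ω : Type*} [MeasurableSpace Ω] {P : Measure Ω}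
    {q W : ℝ → Ω → ℝ} {a b a' b' κ ξ : ℝ} {θ : ℝ → ℝ}
    (hq : IsHullWhiteProcess q a b κ ξ θ W P) (ha : a ≤ a') (hab : a' ≤ b') (hb : b' ≤ b) :
    IsHullWhiteProcess q a' b' κ ξ θ W P where
  aemeasurable t ht := hq.aemeasurable t (Icc_subset_Icc ha hb ht)
  continuous_paths := hq.continuous_paths.mono fun _ h ↦ h.mono (Icc_subset_Icc ha hb)
  integrable_drift := hq.integrable_drift.mono fun _ h ↦ h.mono_set (by
    rw [uIcc_of_le hab, uIcc_of_le (ha.trans (hab.trans hb))]; exact Icc_subset_Icc ha hb)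
  equation := by
    filter_upwards [hq.equation, hq.integrable_drift] with ω h hi t ht
    have hsub : ∀ u ∈ Icc a' b', ∀ v ∈ Icc a b, uIcc v u ⊆ uIcc a b := fun u hu v hv ↦ by
      rw [uIcc_of_le (ha.trans (hab.trans hb))]
      exact uIcc_subset_Icc hv (Icc_subset_Icc ha hb hu)
    have hl : a ∈ Icc a b := ⟨le_rfl, ha.trans (hab.trans hb)⟩
    have hl' : a' ∈ Icc a' b' := ⟨le_rfl, hab⟩
    rw [h t (Icc_subset_Icc ha hb ht), h a' (Icc_subset_Icc ha hb hl'),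
      ← intervalIntegral.integral_add_adjacent_intervals
        (hi.mono_set (hsub a' hl' a hl))
        (hi.mono_set (hsub t ht a' (Icc_subset_Icc ha hb hl')))]
    ring

/-! ### The mean of the process -/

/-- The mean of a Hull-White process follows every solution of `m' = κ (θ - m)` that starts at
its initial mean. -/
lemma IsHullWhiteProcess.integrable_and_integral_eq {Ω : Type*} [MeasurableSpace Ω]
    {P : Measure Ω} [IsProbabilityMeasure P] {q W : ℝ → Ω → ℝ} {a b κ ξ : ℝ} {θ m : ℝ → ℝ}
    (hq : IsHullWhiteProcess q a b κ ξ θ W P) (hW : IsBrownianMotionOn W a b P)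
    (hm : ContinuousOn m (Icc a b))
    (hmd : ∀ t ∈ Ioo a b, HasDerivAt m (κ * (θ t - m t)) t)
    (hqa : Integrable (q a) P) (hqm : ∫ ω, q a ω ∂P = m a) {t : ℝ} (ht : t ∈ Icc a b) :
    Integrable (q t) P ∧ ∫ ω, q t ω ∂P = m t := by
  have ha : a ∈ Icc a b := ⟨le_rfl, ht.1.trans ht.2⟩
  have hsub : Icc a t ⊆ Icc a b := Icc_subset_Icc_right ht.2
  have hlaw : ∀ s ∈ Icc a b, HasLaw (fun ω ↦ W s ω - W a ω) (gaussianReal 0 (s - a).toNNReal) P :=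
    fun s hs ↦ hW.hasLaw_increment a ha s hs hs.1
  have hLp : ∀ s ∈ Icc a b, MemLp (fun ω ↦ W s ω - W a ω) 2 P := fun s hs ↦ by
    have := memLp_id_gaussianReal (μ := 0) (v := (s - a).toNNReal) 2
    rw [← (hlaw s hs).map_eq] at this
    exact this.comp_of_map (hlaw s hs).aemeasurable
  have hint : ∀ s ∈ Icc a b, Integrable (fun ω ↦ W s ω - W a ω) P :=
    fun s hs ↦ (hLp s hs).integrable (by norm_num)
  have hzero : ∀ s ∈ Icc a b, ∫ ω, (W s ω - W a ω) ∂P = 0 := fun s hs ↦ by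
    rw [(hlaw s hs).integral_eq, integral_id_gaussianReal]
  -- From `|x| ≤ 1 + x ^ 2` and the variance `s - a` of the increment.
  have hbound : ∀ s ∈ Icc a b, ∫ ω, |W s ω - W a ω| ∂P ≤ 1 + (b - a) := fun s hs ↦ by
    have hsq : ∫ ω, (W s ω - W a ω) ^ 2 ∂P = s - a := by
      have h1 := (hlaw s hs).variance_eq
      rw [variance_id_gaussianReal, variance_of_integral_eq_zero (hlaw s hs).aemeasurable
        (hzero s hs), Real.coe_toNNReal _ (sub_nonneg.2 hs.1)] at h1
      exact h1
    calc ∫ ω, |W s ω - W a ω| ∂P ≤ ∫ ω, (1 + (W s ω - W a ω) ^ 2) ∂P := by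
          refine integral_mono (hint s hs).abs ((integrable_const 1).add (hLp s hs).integrable_sq)
            fun ω ↦ ?_
          simp only
          nlinarith [sq_abs (W s ω - W a ω), sq_nonneg (|W s ω - W a ω| - 1),
            sq_nonneg (W s ω - W a ω)]
      _ = 1 + (s - a) := by
          rw [integral_add (integrable_const 1) (hLp s hs).integrable_sq, hsq]; simp
      _ ≤ 1 + (b - a) := by linarith [hs.2]
  obtain ⟨hNi, hN0⟩ := integrable_and_integral_intervalIntegral_eq_zero (P := P) ht.1
    (X := fun s ω ↦ W s ω - W a ω) (fun s hs ↦ hint s (hsub hs)) (fun s hs ↦ hzero s (hsub hs))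
    (fun s hs ↦ hbound s (hsub hs))
    (hW.continuous_paths.mono fun ω h ↦ (h.mono hsub).sub continuousOn_const)
    (w := fun s ↦ Real.exp (-κ * (t - s)) * ξ) (by fun_prop)
  have hrep : (fun ω ↦ m t + Real.exp (-κ * (t - a)) * (q a ω - m a) + ξ * (W t ω - W a ω)
      - κ * ∫ s in a..t, Real.exp (-κ * (t - s)) * ξ * (W s ω - W a ω)) =ᵐ[P] q t := by
    filter_upwards [hq.continuous_paths, hq.integrable_drift, hq.equation, hW.continuous_paths]
      with ω hqc hi he hWc
    have hgc : ContinuousOn (fun s ↦ ξ * (W s ω - W a ω)) (Icc a b) := by fun_prop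
    have hyc : ContinuousOn (fun s ↦ q s ω - m s - ξ * (W s ω - W a ω)) (Icc a b) := by fun_prop
    have h := eq_exp_mul_sub_integral_of_integral_equation (κ := κ) hyc hgc ?_ ht
    · simp only [sub_self, mul_zero, sub_zero, ← mul_assoc] at h ⊢
      linarith
    · intro u hu
      have hu' : uIcc a u ⊆ Icc a b := uIcc_subset_Icc ha hu
      have hi' : IntervalIntegrable (fun s ↦ κ * (θ s - q s ω)) volume a u :=
        hi.mono_set (by rwa [uIcc_of_le (ht.1.trans ht.2)])
      have hd : IntervalIntegrable (fun s ↦ -κ * (q s ω - m s)) volume a u :=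
        (ContinuousOn.mono (by fun_prop) hu').intervalIntegrable
      -- No regularity of `θ` is assumed: integrability of `κ (θ - m)` is read off from that of the
      -- drift along a single path.
      have hmi : IntervalIntegrable (fun s ↦ κ * (θ s - m s)) volume a u := by
        refine (hi'.sub hd).congr fun s _ ↦ ?_
        ring
      have hF := intervalIntegral.integral_eq_sub_of_hasDerivAt_of_le hu.1
        (hm.mono (Icc_subset_Icc_right hu.2))
        (fun s hs ↦ hmd s ⟨hs.1, hs.2.trans_le hu.2⟩) hmi
      have hdiff : ∫ s in a..u, -κ * (q s ω - m s - ξ * (W s ω - W a ω) + ξ * (W s ω - W a ω))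
          = (∫ s in a..u, κ * (θ s - q s ω)) - ∫ s in a..u, κ * (θ s - m s) := by
        rw [← intervalIntegral.integral_sub hi' hmi]
        congr 1 with s
        ring
      rw [hdiff, hF, he u hu]
      ring
  have hA : Integrable (fun ω ↦ Real.exp (-κ * (t - a)) * (q a ω - m a)) P :=
    (hqa.sub (integrable_const _)).const_mul _
  have hB : Integrable (fun ω ↦ m t + Real.exp (-κ * (t - a)) * (q a ω - m a)) P :=
    (integrable_const _).add hA
  have hD : Integrable (fun ω ↦ ξ * (W t ω - W a ω)) P := (hint t ht).const_mul ξ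
  have hE : Integrable (fun ω ↦ m t + Real.exp (-κ * (t - a)) * (q a ω - m a)
      + ξ * (W t ω - W a ω)) P := hB.add hD
  refine ⟨(hE.sub (hNi.const_mul κ)).congr hrep, ?_⟩
  rw [← integral_congr_ae hrep, integral_sub hE (hNi.const_mul κ), integral_add hB hD,
    integral_add (integrable_const _) hA, integral_const_mul, integral_const_mul,
    integral_const_mul, hN0, hzero t ht, integral_sub hqa (integrable_const _), hqm]
  simp

theorem lemma3p1 {Ω : Type*} [MeasurableSpace Ω] (P : Measure Ω) [IsProbabilityMeasure P]
    (t₀ T : ℝ) (hT : t₀ < T) (κ ξ : ℝ) (hκ : 0 < κ) (hξ : 0 < ξ)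
    (W : ℝ → Ω → ℝ) (hW : IsBrownianMotionOn W t₀ T P)
    (θ : ℝ → ℝ) (q : ℝ → Ω → ℝ) (hq : IsHullWhiteProcess q t₀ T κ ξ θ W P) :
    -- continuously differentiable curve `qhat` on `[t₀, T]`
    (∀ qhat : ℝ → ℝ, ContDiffOn ℝ 1 qhat (Icc t₀ T) →
      (∀ᵐ ω ∂P, q t₀ ω = qhat t₀) →
      (∀ t ∈ Ioc t₀ T, θ t = qhat t + derivWithin (fun s ↦ (1 / κ) * qhat s) (Icc t₀ T) t) →
      ∀ t ∈ Icc t₀ T, Integrable (q t) P ∧ ∫ ω, q t ω ∂P = qhat t) ∧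
    -- values `qhat k` at the times `τ k` of a grid `t₀ = τ 0 < ⋯ < τ R = T`
    (∀ (R : ℕ) (τ : Fin (R + 1) → ℝ) (qhat : Fin (R + 1) → ℝ),
      StrictMono τ → τ 0 = t₀ → τ (Fin.last R) = T →
      (∀ᵐ ω ∂P, q t₀ ω = qhat 0) →
      (∀ k : Fin R, ∀ t ∈ Ioc (τ k.castSucc) (τ k.succ),
        θ t = (qhat k.succ * Real.exp (κ * τ k.succ)
            - qhat k.castSucc * Real.exp (κ * τ k.castSucc))
          / (Real.exp (κ * τ k.succ) - Real.exp (κ * τ k.castSucc))) →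
      ∀ k : Fin (R + 1), Integrable (q (τ k)) P ∧ ∫ ω, q (τ k) ω ∂P = qhat k) := by
  have init : ∀ c : ℝ, (∀ᵐ ω ∂P, q t₀ ω = c) →
      Integrable (q t₀) P ∧ ∫ ω, q t₀ ω ∂P = c := fun c hc ↦
    ⟨(integrable_const c).congr (hc.mono fun _ h ↦ h.symm), by
      rw [integral_congr_ae hc]; simp⟩
  refine ⟨?_, ?_⟩
  · intro qhat hqhat h0 hθ t ht
    obtain ⟨hi, hm⟩ := init _ h0
    refine hq.integrable_and_integral_eq hW hqhat.continuousOn (fun s hs ↦ ?_) hi hm ht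
    have hd : DifferentiableWithinAt ℝ qhat (Icc t₀ T) s :=
      hqhat.differentiableOn one_ne_zero s (Ioo_subset_Icc_self hs)
    have hn : Icc t₀ T ∈ nhds s := Icc_mem_nhds hs.1 hs.2
    refine (hd.differentiableAt hn).hasDerivAt.congr_deriv ?_
    -- The ODE is only needed at interior times, where the one-sided derivative is the ordinary one.
    rw [hθ s (Ioo_subset_Ioc_self hs), derivWithin_of_mem_nhds hn,
      deriv_const_mul _ (hd.differentiableAt hn)]
    field_simp
    ring
  · intro R τ qhat hτ hτ0 hτR h0 hθ k
    induction k using Fin.induction with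
    | zero => rw [hτ0]; exact init _ h0
    | succ k ih =>
      obtain ⟨hi, hm⟩ := ih
      have hlt : τ k.castSucc < τ k.succ := hτ k.castSucc_lt_succ
      have ha : t₀ ≤ τ k.castSucc := hτ0 ▸ hτ.monotone (Fin.zero_le _)
      have hb : τ k.succ ≤ T := hτR ▸ hτ.monotone (Fin.le_last _)
      have hexp : Real.exp (κ * τ k.succ) - Real.exp (κ * τ k.castSucc) ≠ 0 :=
        (sub_pos.2 (Real.exp_lt_exp.2 (mul_lt_mul_of_pos_left hlt hκ))).ne'
      set c := (qhat k.succ * Real.exp (κ * τ k.succ)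
        - qhat k.castSucc * Real.exp (κ * τ k.castSucc))
          / (Real.exp (κ * τ k.succ) - Real.exp (κ * τ k.castSucc)) with hc
      -- Solution of `m' = κ (c - m)` on the cell, started at the left grid value; `c` is the one
      -- constant for which it reaches the right grid value.
      let m : ℝ → ℝ := fun t ↦ c + (qhat k.castSucc - c) * Real.exp (-κ * (t - τ k.castSucc))
      have hend : m (τ k.succ) = qhat k.succ := by
        have hc' := (eq_div_iff hexp).1 hc
        have hE : Real.exp (-κ * (τ k.succ - τ k.castSucc)) * Real.exp (κ * τ k.succ)
            = Real.exp (κ * τ k.castSucc) := by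
          rw [← Real.exp_add]; ring_nf
        refine mul_right_cancel₀ (Real.exp_pos (κ * τ k.succ)).ne' ?_
        simp only [m]
        linear_combination (qhat k.castSucc - c) * hE + hc'
      rw [← hend]
      refine (hq.mono ha hlt.le hb).integrable_and_integral_eq (hW.mono ha hb)
        (m := m) (Continuous.continuousOn (by fun_prop)) (fun s hs ↦ ?_) hi (by simp [m, hm])
        (right_mem_Icc.2 hlt.le)
      have hd := ((((hasDerivAt_id s).sub_const (τ k.castSucc)).const_mul (-κ)).exp.const_mul
        (qhat k.castSucc - c)).const_add c
      refine hd.congr_deriv ?_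
      rw [hθ k s (Ioo_subset_Ioc_self hs)]
      simp only [m, id]
      ring
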